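/- Let $\Gamma$ be a finite simple graph with $n$ vertices (vertex set $V$) which is triangle-free and $L$-regular (every vertex has exactly $L$ neighbours), let $N\ge 3$ be an integer, and put $m=\lfloor N/2\rfloor$. Let $$\mathrm{NGP}(\Gamma)=\langle\, V \mid v^{N}=1 \ (v\in V),\ uv=vu\ (\{u,v\} \text{ an edge of } \Gamma)\,\rangle$$ be the numbered graph product with all vertex numbers equal to $N$, with its standard generating set $S=V\cup V^{-1}$. A word over $S$ is a geodesic if no shorter word over $S$ represents the same group element. For a word $w$ over $S$ let $\Delta_w(z)=\sum_{d\ge 0}c_d z^d$, where $c_d$ is the number of words $x$ of length $d$ over $S$ such that the concatenation $wx$ is a geodesic. Let $\mathcal G(z)=\Delta_{\varepsilon}(z)$, with $\varepsilon$ the empty word, be the geodesic growth series of $\mathrm{NGP}(\Gamma)$, and let $$\mathcal G_k(z)=\sum_{v\in V}\Delta_{v^k}(z),\qquad \mathcal G_{k,\ell}(z)=\sum_{(u,v)}\Delta_{u^kv^\ell}(z),$$ the second sum being over all ordered pairs $(u,v)$ of adjacent vertices. Then $\mathcal G_{k,\ell}=\mathcal G_{\ell,k}$, and for all $1\le k,\ell\le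 m$ $$\begin{aligned} \mathcal G(z)&=2z\,\mathcal G_1(z)+1,\\ \mathcal G_k(z)&=z\bigl(\mathcal G_{k+1}(z)+2\,\mathcal G_{1,k}(z)+2(n-L-1)\,\mathcal G_1(z)\bigr)+n,\\ \mathcal G_{k,\ell}(z)&=z\bigl(\mathcal G_{k+1,\ell}(z)+\mathcal G_{k,\ell+1}(z)+2(L-1)(\mathcal G_{1,k}(z)+\mathcal G_{1,\ell}(z))+2L(n-2L)\,\mathcal G_1(z)\bigr)+nL, \end{aligned}$$ with the boundary values $\mathcal G_{m+1}(z)=\mathcal G_{m+1,\ell}(z)=\mathcal G_{k,m+1}(z)=0$. Moreover this system determines $\mathcal G$: over any commutative ring $R$, the images in $R[[z]]$ of the series above are the only power series $\mathcal G$, $\mathcal G_k$, $\mathcal G_{k,\ell}$ $(1\le k,\ell\le m)$ that satisfy these equations with these boundary values. -/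

import Mathlib

/-- The growth series of a language `l`: the coefficient of `z ^ d` is the number of words of
length `d` in `l` (read in the coefficient ring `R`). The alphabet is meant to be finite. -/
noncomputable def growthSeries (R : Type*) [CommRing R] {α : Type*} (l : Language α) :
    PowerSeries R :=
  PowerSeries.mk fun d => (({w : List α | w ∈ l ∧ w.length = d}.ncard : ℕ) : R)

/-- The element of `G` to which a word over `S ⊆ G` evaluates. -/
def evalWord {G : Type*} [Group G] {S : Set G} (w : List S) : G :=
  (w.map Subtype.val).prod

/-- The geodesic language of `(G, S)`: the words over `S` such that no shorter word over `S`
evaluates to the same element of `G`. -/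
def geodesicLanguage {G : Type*} [Group G] (S : Set G) : Language S :=
  {w : List S | ∀ w' : List S, evalWord w' = evalWord w → w.length ≤ w'.length}

namespace NGP

/-- The defining relators of the numbered graph product of `(Γ, N)`: the powers `v ^ N(v)` for all
vertices `v`, and the commutators `[u, v]` for all edges `{u, v}`. -/
def rels {V : Type*} (Γ : SimpleGraph V) (N : V → ℕ) : Set (FreeGroup V) :=
  {r | ∃ v : V, r = FreeGroup.of v ^ N v} ∪
    {r | ∃ u v : V, Γ.Adj u v ∧
      r = FreeGroup.of u * FreeGroup.of v * (FreeGroup.of u)⁻¹ * (FreeGroup.of v)⁻¹}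

end NGP

/-- The numbered graph product of `(Γ, N)`: the graph product over `Γ` of the cyclic groups
`⟨v ∣ v ^ N(v) = 1⟩`. -/
abbrev NGP {V : Type*} (Γ : SimpleGraph V) (N : V → ℕ) : Type _ :=
  PresentedGroup (NGP.rels Γ N)

namespace NGP

/-- The generator of the numbered graph product attached to the vertex `v`. -/
def gen {V : Type*} (Γ : SimpleGraph V) (N : V → ℕ) (v : V) : NGP Γ N :=
  PresentedGroup.of v

/-- The standard generating set: the vertices and their inverses, as a subset of the group. -/
def stdGens {V : Type*} (Γ : SimpleGraph V) (N : V → ℕ) : Set (NGP Γ N) :=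
  Set.range (gen Γ N) ∪ Set.range fun v => (gen Γ N v)⁻¹

/-- The vertex `v` as a letter of the standard alphabet. -/
def letter {V : Type*} (Γ : SimpleGraph V) (N : V → ℕ) (v : V) : stdGens Γ N :=
  ⟨gen Γ N v, Or.inl ⟨v, rfl⟩⟩

/-- The word `v ^ k = v ⋯ v`, with `k` letters. -/
def powWord {V : Type*} (Γ : SimpleGraph V) (N : V → ℕ) (v : V) (k : ℕ) : List (stdGens Γ N) :=
  List.replicate k (letter Γ N v)

/-- The geodesic growth series of the numbered graph product, with respect to its standard
generating set. -/
noncomputable def geodesicGrowth (R : Type*) [CommRing R] {V : Type*} (Γ : SimpleGraph V)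
    (N : V → ℕ) : PowerSeries R :=
  growthSeries R (geodesicLanguage (stdGens Γ N))

/-- The growth series of the language of all words `x` such that `w x` is a geodesic. -/
noncomputable def contGrowth (R : Type*) [CommRing R] {V : Type*} (Γ : SimpleGraph V)
    (N : V → ℕ) (w : List (stdGens Γ N)) : PowerSeries R :=
  growthSeries R ((geodesicLanguage (stdGens Γ N)).leftQuotient w)

/-- The auxiliary series `G_k`: the sum over all vertices `v` of the growth series of the
language of continuations of the word `v ^ k`. It is zero as soon as the words `v ^ k` are not
geodesic. -/
noncomputable def vertexSeries (R : Type*) [CommRing R] {V : Type*} [Fintype V]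
    (Γ : SimpleGraph V) (N : V → ℕ) (k : ℕ) : PowerSeries R :=
  ∑ v : V, contGrowth R Γ N (powWord Γ N v k)

/-- The auxiliary series `G_{k,l}`: the sum over all directed edges `(u, v)` of the growth series
of the language of continuations of the word `u ^ k v ^ l`. -/
noncomputable def edgeSeries (R : Type*) [CommRing R] {V : Type*} [Fintype V]
    (Γ : SimpleGraph V) [DecidableRel Γ.Adj] (N : V → ℕ) (k l : ℕ) : PowerSeries R :=
  ∑ u : V, ∑ v ∈ Γ.neighborFinset u, contGrowth R Γ N (powWord Γ N u k ++ powWord Γ N v l)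

open PowerSeries in
/-- The linear system with parameters `n`, `L`, `m` in the unknown power series `g`, `a k`, `b k l`
(the indices that matter are `1 ≤ k, l ≤ m`, and `m + 1` for the boundary conditions). -/
structure IsSolution {R : Type*} [CommRing R] (n L m : ℕ) (g : PowerSeries R)
    (a : ℕ → PowerSeries R) (b : ℕ → ℕ → PowerSeries R) : Prop where
  start : g = 2 * X * a 1 + 1
  vertex : ∀ k, 1 ≤ k → k ≤ m →
    a k = X * (a (k + 1) + 2 * b 1 k
      + 2 * ((n : PowerSeries R) - (L : PowerSeries R) - 1) * a 1) + (n : PowerSeries R)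
  edge : ∀ k l, 1 ≤ k → k ≤ m → 1 ≤ l → l ≤ m →
    b k l = X * (b (k + 1) l + b k (l + 1)
      + 2 * ((L : PowerSeries R) - 1) * (b 1 k + b 1 l)
      + 2 * (L : PowerSeries R) * ((n : PowerSeries R) - 2 * (L : PowerSeries R)) * a 1)
      + (n : PowerSeries R) * (L : PowerSeries R)
  vertex_boundary : a (m + 1) = 0
  edge_boundary_left : ∀ l, 1 ≤ l → l ≤ m → b (m + 1) l = 0
  edge_boundary_right : ∀ k, 1 ≤ k → k ≤ m → b k (m + 1) = 0

end NGP

/-! Group elements are modelled by piles of syllables `v ^ c`: syllables of adjacent vertices slide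
past each other, those of distinct non-adjacent vertices block. The group acts on the piles that can
be built, so each element has a single pile (`rep_pile`). A letter changes one exponent by 1 or -1
modulo `N`, so the total length of the pile, an exponent counting as its least absolute residue, is
the word length (`geodesic_iff_pileNorm_eq`).

If `s x` is geodesic and `s` is `w` or its inverse, a syllable of `w` lies on top of the pile, so
none of a vertex `v ≠ w` not adjacent to `w` does. Hence `v ^ k s x` is geodesic for `k ≤ N / 2`:
before a letter of `w`, the prefix `v ^ k` can be dropped. For a prefix `u ^ k v ^ l` on an edge,
triangle-freeness makes `w` non-adjacent to one of `u`, `v`, and that power can be moved to the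
front and dropped. Automorphisms inverting one generator equate the contributions of `w` and its
inverse, whence the factors 2. Splitting continuations by their first letter (`contGrowth_eq`) and
summing over vertices or directed edges gives the system.

For uniqueness, all unknowns on the right carry a factor `X`, so the differences of two solutions
are divisible by every power of `X`. -/

namespace NGP

/-! ### Piles -/

section Pile

open scoped Classical in
/-- Put a syllable `v ^ c` on top of a pile: a bead `c` on the stack of `v`, and a blocking bead
`0` on the stacks of all vertices that do not commute with `v`. -/
noncomputable def put {V : Type*} (Γ : SimpleGraph V) {N : ℕ} (v : V) (c : ZMod N)
    (π : V → List (ZMod N)) : V → List (ZMod N) :=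
  if c = 0 then π else fun u => if u = v then c :: π u else if Γ.Adj v u then π u else 0 :: π u

/-- The exponent of the syllable of `v` that lies on top of a pile, and `0` if there is none. -/
def front {V : Type*} {N : ℕ} (v : V) (π : V → List (ZMod N)) : ZMod N :=
  (π v).headD 0

open scoped Classical in
/-- Remove the top syllable of `v` from a pile. -/
noncomputable def pop {V : Type*} (Γ : SimpleGraph V) {N : ℕ} (v : V)
    (π : V → List (ZMod N)) : V → List (ZMod N) :=
  if front v π = 0 then π else fun u => if Γ.Adj v u then π u else (π u).tail

/-- Multiply a pile by `v ^ a` from the top. -/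
noncomputable def act {V : Type*} (Γ : SimpleGraph V) {N : ℕ} (v : V) (a : ZMod N)
    (π : V → List (ZMod N)) : V → List (ZMod N) :=
  put Γ v (front v π + a) (pop Γ v π)

/-- The total length of the syllables of a pile. -/
def pileLength {V : Type*} [Fintype V] {N : ℕ} (π : V → List (ZMod N)) : ℕ :=
  ∑ v, ((π v).map fun c => c.valMinAbs.natAbs).sum

variable {V : Type*} {Γ : SimpleGraph V} {N : ℕ} {u v : V} {c d : ZMod N}
  {π : V → List (ZMod N)}

@[simp]
lemma put_zero : put Γ v (0 : ZMod N) π = π := by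
  simp [put]

lemma front_put_self (h : front v π = 0) : front v (put Γ v c π) = c := by
  by_cases hc : c = 0
  · simp [hc, h]
  · simp [put, front, hc]

lemma front_put_of_adj (h : Γ.Adj v u) : front u (put Γ v c π) = front u π := by
  by_cases hc : c = 0
  · simp [hc]
  · simp [put, front, hc, h, h.ne']

lemma front_put_of_not_adj (hc : c ≠ 0) (hne : u ≠ v) (h : ¬ Γ.Adj v u) :
    front u (put Γ v c π) = 0 := by
  simp [put, front, hc, h, hne]

lemma put_comm (h : Γ.Adj u v) : put Γ u c (put Γ v d π) = put Γ v d (put Γ u c π) := by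
  by_cases hc : c = 0
  · simp [hc]
  by_cases hd : d = 0
  · simp [hd]
  funext w
  have := h.ne
  have := h.symm
  simp only [put, hc, hd, if_false]
  by_cases hu : w = u
  · subst hu; simp [*]
  by_cases hv : w = v
  · subst hv; simp [*]
  simp only [hu, hv, if_false]
  split_ifs <;> rfl

lemma pop_put (h : front v π = 0) : pop Γ v (put Γ v c π) = π := by
  by_cases hc : c = 0
  · simp [hc, pop, h]
  · rw [pop, front_put_self h, if_neg hc]
    funext w
    by_cases hw : w = v
    · subst hw; simp [put, hc]
    · by_cases ha : Γ.Adj v w <;> simp [put, hc, hw, ha]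

/-- Reduces the action to addition of exponents. Merging and cancellation need no separate cases,
since putting the exponent 0 changes nothing. -/
lemma act_put (a : ZMod N) (h : front v π = 0) :
    act Γ v a (put Γ v c π) = put Γ v (c + a) π := by
  rw [act, front_put_self h, pop_put h]

/-- Blocking beads are 0 and contribute no length. -/
lemma pileLength_put [Fintype V] :
    pileLength (put Γ v c π) = c.valMinAbs.natAbs + pileLength π := by
  by_cases hc : c = 0
  · simp [hc]
  · classical
    have h : ∀ w, ((put Γ v c π w).map fun c => c.valMinAbs.natAbs).sum =
        (if w = v then c.valMinAbs.natAbs else 0) +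
          ((π w).map fun c => c.valMinAbs.natAbs).sum := by
      intro w
      simp only [put, hc, if_false]
      split_ifs <;> simp
    simp only [pileLength, h, Finset.sum_add_distrib]
    simp

end Pile

/-! ### Powers of the generators -/

section GenPow

variable {V : Type*} (Γ : SimpleGraph V) (N : ℕ)

lemma gen_pow_eq_one (v : V) : gen Γ (fun _ => N) v ^ N = 1 := by
  have : FreeGroup.of v ^ N ∈ rels Γ (fun _ => N) := Or.inl ⟨v, rfl⟩
  exact PresentedGroup.one_of_mem this

lemma gen_commute {u v : V} (h : Γ.Adj u v) :
    Commute (gen Γ (fun _ => N) u) (gen Γ (fun _ => N) v) := by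
  have : FreeGroup.of u * FreeGroup.of v * (FreeGroup.of u)⁻¹ * (FreeGroup.of v)⁻¹ ∈
    rels Γ (fun _ => N) := Or.inr ⟨u, v, h, rfl⟩
  have := PresentedGroup.one_of_mem this
  simp only [map_mul, map_inv] at this
  rwa [mul_inv_eq_one, mul_inv_eq_iff_eq_mul] at this

/-- The power of a generator with exponent in `ZMod N`. -/
def genPow (v : V) (a : ZMod N) : NGP Γ (fun _ => N) :=
  gen Γ (fun _ => N) v ^ a.valMinAbs

lemma genPow_intCast (v : V) (i : ℤ) : genPow Γ N v (i : ZMod N) = gen Γ (fun _ => N) v ^ i := by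
  have h : (N : ℤ) ∣ i - (i : ZMod N).valMinAbs := by
    rw [← ZMod.intCast_eq_intCast_iff_dvd_sub]
    simp
  obtain ⟨j, hj⟩ := h
  have h1 : gen Γ (fun _ => N) v ^ (i - (i : ZMod N).valMinAbs) = 1 := by
    rw [hj, zpow_mul, zpow_natCast, gen_pow_eq_one, one_zpow]
  rw [zpow_sub, mul_inv_eq_one] at h1
  exact h1.symm

lemma genPow_natCast (v : V) (k : ℕ) : genPow Γ N v (k : ZMod N) = gen Γ (fun _ => N) v ^ k := by
  simpa using genPow_intCast Γ N v k

@[simp]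
lemma genPow_zero (v : V) : genPow Γ N v 0 = 1 := by
  simp [genPow]

lemma genPow_one (v : V) : genPow Γ N v 1 = gen Γ (fun _ => N) v := by
  simpa using genPow_natCast Γ N v 1

lemma genPow_neg_one (v : V) : genPow Γ N v (-1) = (gen Γ (fun _ => N) v)⁻¹ := by
  simpa using genPow_intCast Γ N v (-1)

lemma genPow_add (v : V) (a b : ZMod N) :
    genPow Γ N v (a + b) = genPow Γ N v a * genPow Γ N v b := by
  obtain ⟨i, rfl⟩ := ZMod.intCast_surjective a
  obtain ⟨j, rfl⟩ := ZMod.intCast_surjective b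
  rw [← Int.cast_add]
  simp only [genPow_intCast, zpow_add]

lemma genPow_commute {u v : V} (h : Γ.Adj u v) (a b : ZMod N) :
    Commute (genPow Γ N u a) (genPow Γ N v b) :=
  ((gen_commute Γ N h).zpow_left _).zpow_right _

end GenPow

/-! ### The piles of the group elements -/

/-- `Rep Γ π g`: the pile `π` is built from a product of syllables with value `g`. -/
inductive Rep {V : Type*} (Γ : SimpleGraph V) {N : ℕ} :
    (V → List (ZMod N)) → NGP Γ (fun _ => N) → Prop
  | nil : Rep Γ (fun _ => []) 1
  | put (v : V) (c : ZMod N) (π : V → List (ZMod N)) (g : NGP Γ (fun _ => N)) :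
      front v π = 0 → Rep Γ π g → Rep Γ (put Γ v c π) (genPow Γ N v c * g)

section Rep

variable {V : Type*} {Γ : SimpleGraph V} {N : ℕ}

/-- The top syllable of `v` can be taken to be the last one placed. If the last one belongs to a
neighbour of `v`, the two are exchanged; if it belongs to another non-adjacent vertex, it blocks `v`
and the front is 0. -/
lemma Rep.exists_eq_put {π : V → List (ZMod N)} {g : NGP Γ (fun _ => N)} (h : Rep Γ π g)
    (v : V) : ∃ β g', front v β = 0 ∧ Rep Γ β g' ∧ π = NGP.put Γ v (front v π) β ∧
      g = genPow Γ N v (front v π) * g' := by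
  induction h with
  | nil => exact ⟨_, 1, rfl, Rep.nil, by simp [front], by simp [front]⟩
  | put u c π g hf hr ih =>
    by_cases hc : c = 0
    · simpa [hc] using ih
    by_cases huv : v = u
    · subst huv
      exact ⟨π, g, hf, hr, by rw [front_put_self hf], by rw [front_put_self hf]⟩
    by_cases ha : Γ.Adj u v
    · obtain ⟨β, g', h0, hr', hπ, hg⟩ := ih
      have hu : front u β = 0 := by
        rw [hπ, front_put_of_adj ha.symm] at hf
        exact hf
      refine ⟨NGP.put Γ u c β, genPow Γ N u c * g', ?_, Rep.put u c β g' hu hr', ?_, ?_⟩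
      · rw [front_put_of_adj ha, h0]
      · rw [front_put_of_adj ha, put_comm ha.symm, ← hπ]
      · rw [front_put_of_adj ha, ← mul_assoc, (genPow_commute Γ N ha.symm _ _).eq, mul_assoc, ← hg]
    · have h0 := front_put_of_not_adj (π := π) hc huv ha
      exact ⟨_, _, h0, Rep.put u c π g hf hr, by simp [h0], by simp [h0]⟩

lemma Rep.act {π : V → List (ZMod N)} {g : NGP Γ (fun _ => N)} (h : Rep Γ π g) (v : V)
    (a : ZMod N) : Rep Γ (act Γ v a π) (genPow Γ N v a * g) := by
  obtain ⟨β, g', h0, hr, hπ, hg⟩ := h.exists_eq_put v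
  rw [hπ, act_put a h0, hg, ← mul_assoc, ← genPow_add, add_comm a]
  exact Rep.put v _ β g' h0 hr

lemma Rep.front_eq_zero {π : V → List (ZMod N)} {g : NGP Γ (fun _ => N)} (h : Rep Γ π g)
    {u v : V} (hu : front u π ≠ 0) (hne : v ≠ u) (ha : ¬ Γ.Adj u v) : front v π = 0 := by
  obtain ⟨β, g', h0, hr, hπ, hg⟩ := h.exists_eq_put u
  rw [hπ]
  exact front_put_of_not_adj hu hne ha

/-! ### The group acts on the buildable piles -/

variable (Γ N) in
/-- The piles that are built from syllables. -/
abbrev Pile : Type _ := {π : V → List (ZMod N) // ∃ g, Rep Γ π g}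

/-- The action of `v ^ a` on the piles. -/
noncomputable def Pile.act (v : V) (a : ZMod N) (π : Pile Γ N) : Pile Γ N :=
  ⟨NGP.act Γ v a π.1, π.2.imp' (genPow Γ N v a * ·) fun _ h => h.act v a⟩

/-- Buildability matters: on an arbitrary family of stacks, popping may discard beads that putting
back does not restore. -/
lemma Pile.act_act (v : V) (a b : ZMod N) (π : Pile Γ N) :
    (π.act v b).act v a = π.act v (b + a) := by
  obtain ⟨π, g, h⟩ := π
  obtain ⟨β, g', h0, hr, hπ, hg⟩ := h.exists_eq_put v
  apply Subtype.ext
  simp only [Pile.act]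
  rw [hπ, act_put b h0, act_put a h0, act_put _ h0, add_assoc]

lemma Pile.act_zero (v : V) (π : Pile Γ N) : π.act v 0 = π := by
  obtain ⟨π, g, h⟩ := π
  obtain ⟨β, g', h0, hr, hπ, hg⟩ := h.exists_eq_put v
  apply Subtype.ext
  simp only [Pile.act]
  rw [hπ, act_put _ h0, add_zero]

/-- Extract the syllables of both `v` and `u`; over the common remainder `γ` each action only
changes its own exponent. -/
lemma Pile.act_comm {u v : V} (huv : Γ.Adj u v) (a b : ZMod N) (π : Pile Γ N) :
    (π.act v b).act u a = (π.act u a).act v b := by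
  obtain ⟨π, g, h⟩ := π
  obtain ⟨β, g', h0, hr, hπ, hg⟩ := h.exists_eq_put v
  obtain ⟨γ, g'', h0', hr', hβ, hg'⟩ := hr.exists_eq_put u
  have hv : front v γ = 0 := by
    rwa [hβ, front_put_of_adj huv] at h0
  have hv' (c : ZMod N) : front v (put Γ u c γ) = 0 := by rwa [front_put_of_adj huv]
  have hu' (c : ZMod N) : front u (put Γ v c γ) = 0 := by rwa [front_put_of_adj huv.symm]
  apply Subtype.ext
  simp only [Pile.act]
  rw [hπ, hβ, act_put _ (hv' _), put_comm huv.symm, act_put _ (hu' _), put_comm huv.symm,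
    act_put _ (hu' _), ← put_comm huv.symm, ← put_comm huv.symm, act_put _ (hv' _)]

/-- The permutation of the piles given by a generator. -/
noncomputable def Pile.perm (v : V) : Equiv.Perm (Pile Γ N) where
  toFun := Pile.act v 1
  invFun := Pile.act v (-1)
  left_inv π := by rw [Pile.act_act, add_neg_cancel, Pile.act_zero]
  right_inv π := by rw [Pile.act_act, neg_add_cancel, Pile.act_zero]

lemma Pile.perm_pow_apply (v : V) (k : ℕ) (π : Pile Γ N) :
    (Pile.perm v ^ k) π = π.act v (k : ZMod N) := by
  induction k with
  | zero => simp [Pile.act_zero]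
  | succ k ih =>
    rw [pow_succ', Equiv.Perm.mul_apply, ih, Nat.cast_succ, ← Pile.act_act]
    rfl

variable (Γ N) in
/-- The action of the group on the piles. -/
noncomputable def toPerm : NGP Γ (fun _ => N) →* Equiv.Perm (Pile Γ N) :=
  PresentedGroup.toGroup (f := Pile.perm) <| by
    rintro r (⟨v, rfl⟩ | ⟨u, v, huv, rfl⟩)
    · ext1 π
      rw [map_pow, FreeGroup.lift_apply_of, Pile.perm_pow_apply, ZMod.natCast_self, Pile.act_zero]
      rfl
    · simp only [map_mul, map_inv, FreeGroup.lift_apply_of]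
      rw [mul_inv_eq_one, mul_inv_eq_iff_eq_mul]
      ext1 π
      exact Pile.act_comm huv 1 1 π

lemma toPerm_genPow_apply (v : V) (a : ZMod N) (π : Pile Γ N) :
    toPerm Γ N (genPow Γ N v a) π = π.act v a := by
  have h1 (π : Pile Γ N) : toPerm Γ N (gen Γ (fun _ => N) v) π = π.act v 1 := by
    simp only [toPerm, gen, PresentedGroup.toGroup.of]
    rfl
  have h2 (k : ℕ) (π : Pile Γ N) :
      toPerm Γ N (gen Γ (fun _ => N) v ^ k) π = π.act v (k : ZMod N) := by
    rw [map_pow, ← Pile.perm_pow_apply]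
    congr 2
  obtain ⟨i, rfl⟩ := ZMod.intCast_surjective a
  rw [genPow_intCast]
  obtain ⟨k, rfl | rfl⟩ := i.eq_nat_or_neg
  · simpa using h2 k π
  · rw [zpow_neg, map_inv, Equiv.Perm.inv_eq_iff_eq, zpow_natCast, h2, Pile.act_act]
    simp [Pile.act_zero]

/-- The pile of a group element. -/
noncomputable def pile (g : NGP Γ (fun _ => N)) : V → List (ZMod N) :=
  (toPerm Γ N g ⟨fun _ => [], 1, Rep.nil⟩).1

lemma pile_genPow_mul (v : V) (a : ZMod N) (g : NGP Γ (fun _ => N)) :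
    pile (genPow Γ N v a * g) = act Γ v a (pile g) := by
  rw [pile, map_mul, Equiv.Perm.mul_apply, toPerm_genPow_apply]
  rfl

lemma pile_one : pile (1 : NGP Γ (fun _ => N)) = fun _ => [] := by
  simp [pile]

lemma rep_pile (g : NGP Γ (fun _ => N)) : Rep Γ (pile g) g := by
  -- Stated for left multiplication of an arbitrary `h`, so that the case of a product is a
  -- composition.
  have key : ∀ (x : FreeGroup V) (h : NGP Γ (fun _ => N)), Rep Γ (pile h) h →
      Rep Γ (pile (PresentedGroup.mk (rels Γ fun _ => N) x * h))
        (PresentedGroup.mk (rels Γ fun _ => N) x * h) := by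
    intro x
    induction x using FreeGroup.induction_on with
    | C1 => simp
    | of v =>
      intro h hh
      change Rep Γ (pile (gen Γ (fun _ => N) v * h)) (gen Γ (fun _ => N) v * h)
      rw [← genPow_one, pile_genPow_mul]
      exact hh.act v 1
    | inv_of v _ =>
      intro h hh
      change Rep Γ (pile ((gen Γ (fun _ => N) v)⁻¹ * h)) ((gen Γ (fun _ => N) v)⁻¹ * h)
      rw [← genPow_neg_one, pile_genPow_mul]
      exact hh.act v (-1)
    | mul x y hx hy =>
      intro h hh
      rw [map_mul, mul_assoc]
      exact hx _ (hy _ hh)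
  obtain ⟨x, rfl⟩ := PresentedGroup.mk_surjective (rels Γ fun _ => N) g
  simpa using key x 1 (by rw [pile_one]; exact Rep.nil)

end Rep

end NGP

/-! ### Geodesic words -/

section Geodesic

variable {G : Type*} [Group G] {S : Set G}

@[simp]
lemma evalWord_nil : evalWord ([] : List S) = 1 := rfl

@[simp]
lemma evalWord_cons (s : S) (w : List S) : evalWord (s :: w) = s * evalWord w := by
  simp [evalWord]

@[simp]
lemma evalWord_append (w x : List S) : evalWord (w ++ x) = evalWord w * evalWord x := by
  simp [evalWord]

@[simp]
lemma evalWord_replicate (k : ℕ) (s : S) : evalWord (List.replicate k s) = (s : G) ^ k := by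
  simp [evalWord]

lemma mem_geodesicLanguage_iff {w : List S} : w ∈ geodesicLanguage S ↔
    ∀ w' : List S, evalWord w' = evalWord w → w.length ≤ w'.length := Iff.rfl

lemma geodesic_of_append_left {w x : List S} (h : w ++ x ∈ geodesicLanguage S) :
    w ∈ geodesicLanguage S := by
  intro w' hw'
  have := h (w' ++ x) (by simp [hw'])
  simpa using this

lemma geodesic_of_append_right {w x : List S} (h : w ++ x ∈ geodesicLanguage S) :
    x ∈ geodesicLanguage S := by
  intro x' hx'
  have := h (w ++ x') (by simp [hx'])
  simpa using this

lemma geodesic_congr {w w' : List S} (h : evalWord w = evalWord w')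
    (hl : w.length = w'.length) : w ∈ geodesicLanguage S ↔ w' ∈ geodesicLanguage S := by
  simp only [mem_geodesicLanguage_iff, h, hl]

lemma nil_mem_geodesicLanguage : ([] : List S) ∈ geodesicLanguage S :=
  fun _ _ => Nat.zero_le _

end Geodesic

namespace NGP

variable {V : Type*} {Γ : SimpleGraph V} {N : ℕ}

/-! ### The standard alphabet -/

variable (Γ N) in
/-- The inverse of the vertex `v` as a letter of the standard alphabet. -/
def invLetter (v : V) : stdGens Γ (fun _ => N) :=
  ⟨(gen Γ (fun _ => N) v)⁻¹, Or.inr ⟨v, rfl⟩⟩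

/-- The letter `s` is the vertex `v` or its inverse. -/
def IsLetter (v : V) (s : stdGens Γ (fun _ => N)) : Prop :=
  s = letter Γ (fun _ => N) v ∨ s = invLetter Γ N v

lemma isLetter_letter (v : V) : IsLetter v (letter Γ (fun _ => N) v) := Or.inl rfl

lemma isLetter_invLetter (v : V) : IsLetter v (invLetter Γ N v) := Or.inr rfl

lemma exists_isLetter (s : stdGens Γ (fun _ => N)) : ∃ v, IsLetter v s := by
  obtain ⟨s, ⟨v, rfl⟩ | ⟨v, rfl⟩⟩ := s
  · exact ⟨v, isLetter_letter v⟩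
  · exact ⟨v, isLetter_invLetter v⟩

lemma IsLetter.exists_eq_genPow {v : V} {s : stdGens Γ (fun _ => N)} (h : IsLetter v s) :
    ∃ a : ZMod N, a.valMinAbs.natAbs ≤ 1 ∧ (s : NGP Γ fun _ => N) = genPow Γ N v a := by
  have h1 : (1 : ZMod N).valMinAbs.natAbs ≤ 1 := by
    rcases Nat.eq_zero_or_pos N with rfl | hN
    · simp
    have : NeZero N := ⟨hN.ne'⟩
    rcases Nat.lt_or_ge N 2 with h2 | h2
    · obtain rfl : N = 1 := by lia
      have := ZMod.natAbs_valMinAbs_le (1 : ZMod 1)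
      lia
    · have := ZMod.valMinAbs_natCast_of_le_half (n := N) (a := 1) (by lia)
      simp only [Nat.cast_one] at this
      simp [this]
  rcases h with rfl | rfl
  · exact ⟨1, h1, (genPow_one Γ N v).symm⟩
  · exact ⟨-1, by rwa [ZMod.natAbs_valMinAbs_neg], (genPow_neg_one Γ N v).symm⟩

lemma evalWord_powWord (v : V) (k : ℕ) :
    evalWord (powWord Γ (fun _ => N) v k) = genPow Γ N v (k : ZMod N) := by
  rw [genPow_natCast, powWord, evalWord_replicate]
  rfl

@[simp]
lemma length_powWord (v : V) (k : ℕ) : (powWord Γ (fun _ => N) v k).length = k := by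
  simp [powWord]

lemma powWord_append_letter (v : V) (k : ℕ) :
    powWord Γ (fun _ => N) v k ++ [letter Γ (fun _ => N) v] = powWord Γ (fun _ => N) v (k + 1) := by
  simp [powWord, List.replicate_succ']

lemma not_geodesic_powWord_append_invLetter {k : ℕ} (hk : 1 ≤ k) (v : V) :
    powWord Γ (fun _ => N) v k ++ [invLetter Γ N v] ∉
      geodesicLanguage (stdGens Γ fun _ => N) := by
  obtain ⟨k, rfl⟩ := Nat.exists_eq_add_of_le' hk
  intro h
  have := h (powWord Γ _ v k) (by simp [powWord, letter, invLetter, pow_succ])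
  simp at this

lemma geodesic_powWord_powWord_comm {u v : V} (huv : Γ.Adj u v) (k l : ℕ)
    (x : List (stdGens Γ fun _ => N)) :
    (powWord Γ (fun _ => N) u k ++ powWord Γ (fun _ => N) v l) ++ x ∈
        geodesicLanguage (stdGens Γ fun _ => N) ↔
      (powWord Γ (fun _ => N) v l ++ powWord Γ (fun _ => N) u k) ++ x ∈
        geodesicLanguage (stdGens Γ fun _ => N) := by
  apply geodesic_congr
  · simp only [evalWord_append, evalWord_powWord, (genPow_commute Γ N huv _ _).eq]
  · simp only [List.length_append, length_powWord, add_comm k l]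

/-! ### Fronts and lengths of group elements -/

/-- A single `β` serves all exponents, so that fronts and lengths of `g` (the case `a = 0`) and of
its multiples by powers of `v` can be compared. -/
lemma exists_pile_eq_put (g : NGP Γ (fun _ => N)) (v : V) : ∃ β : V → List (ZMod N),
    front v β = 0 ∧ ∀ a, pile (genPow Γ N v a * g) = put Γ v (front v (pile g) + a) β := by
  obtain ⟨β, g', h0, hr, hπ, hg⟩ := (rep_pile g).exists_eq_put v
  refine ⟨β, h0, fun a => ?_⟩
  rw [pile_genPow_mul]
  nth_rw 1 [hπ]
  rw [act_put a h0]

lemma front_pile_genPow_mul (g : NGP Γ (fun _ => N)) (v : V) (a : ZMod N) :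
    front v (pile (genPow Γ N v a * g)) = front v (pile g) + a := by
  obtain ⟨β, h0, h⟩ := exists_pile_eq_put g v
  rw [h, front_put_self h0]

lemma front_pile_genPow_mul_of_adj (g : NGP Γ (fun _ => N)) {u v : V} (huv : Γ.Adj v u)
    (a : ZMod N) : front u (pile (genPow Γ N v a * g)) = front u (pile g) := by
  obtain ⟨β, h0, h⟩ := exists_pile_eq_put g v
  have h1 := h 0
  rw [genPow_zero, one_mul] at h1
  rw [h, front_put_of_adj huv, h1, front_put_of_adj huv]

lemma front_pile_eq_zero {g : NGP Γ (fun _ => N)} {u v : V} (hu : front u (pile g) ≠ 0)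
    (hne : v ≠ u) (huv : ¬ Γ.Adj u v) : front v (pile g) = 0 :=
  (rep_pile g).front_eq_zero hu hne huv

lemma front_pile_one (v : V) : front v (pile (1 : NGP Γ (fun _ => N))) = 0 := by
  rw [pile_one]
  rfl

section Length

variable [Fintype V]

/-- The length of a group element, computed from its pile. -/
noncomputable def pileNorm (g : NGP Γ (fun _ => N)) : ℕ :=
  pileLength (pile g)

lemma pileNorm_genPow_mul (g : NGP Γ (fun _ => N)) (v : V) (a : ZMod N) :
    pileNorm (genPow Γ N v a * g) + (front v (pile g)).valMinAbs.natAbs =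
      pileNorm g + (front v (pile g) + a).valMinAbs.natAbs := by
  obtain ⟨β, h0, h⟩ := exists_pile_eq_put g v
  have h1 := h 0
  rw [genPow_zero, one_mul, add_zero] at h1
  rw [pileNorm, pileNorm, h, pileLength_put]
  nth_rw 3 [h1]
  rw [pileLength_put]
  lia

lemma pileNorm_evalWord_le (w : List (stdGens Γ fun _ => N)) :
    pileNorm (evalWord w) ≤ w.length := by
  induction w with
  | nil => simp [pileNorm, pile_one, pileLength]
  | cons s w ih =>
    obtain ⟨v, hv⟩ := exists_isLetter s
    obtain ⟨a, ha, hs⟩ := hv.exists_eq_genPow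
    have h1 := pileNorm_genPow_mul (evalWord w) v a
    have h2 := ZMod.natAbs_valMinAbs_add_le (front v (pile (evalWord w))) a
    have h3 := Int.natAbs_add_le (front v (pile (evalWord w))).valMinAbs a.valMinAbs
    rw [evalWord_cons, hs, List.length_cons]
    lia

lemma Rep.exists_word {π : V → List (ZMod N)} {g : NGP Γ (fun _ => N)} (h : Rep Γ π g) :
    ∃ w : List (stdGens Γ fun _ => N), evalWord w = g ∧ w.length = pileLength π := by
  induction h with
  | nil => exact ⟨[], rfl, by simp [pileLength]⟩
  | put v c π g hf hr ih =>
    obtain ⟨w, rfl, hw⟩ := ih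
    suffices h : ∃ x : List (stdGens Γ fun _ => N), evalWord x = genPow Γ N v c ∧
        x.length = c.valMinAbs.natAbs by
      obtain ⟨x, hx, hl⟩ := h
      exact ⟨x ++ w, by simp [hx], by rw [pileLength_put, List.length_append, hl, hw]⟩
    rw [genPow]
    obtain ⟨k, hk | hk⟩ := c.valMinAbs.eq_nat_or_neg
    · exact ⟨List.replicate k (letter Γ _ v), by simp [hk, letter], by simp [hk]⟩
    · exact ⟨List.replicate k (invLetter Γ N v), by simp [hk, invLetter], by simp [hk]⟩

/-- `pileNorm` is the word length: no word is shorter than it, and spelling out the syllables of the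
pile attains it. -/
lemma geodesic_iff_pileNorm_eq {w : List (stdGens Γ fun _ => N)} :
    w ∈ geodesicLanguage (stdGens Γ fun _ => N) ↔ pileNorm (evalWord w) = w.length := by
  constructor
  · intro h
    obtain ⟨w', h1, h2⟩ := (rep_pile (evalWord w)).exists_word
    exact (pileNorm_evalWord_le w).antisymm ((h w' h1).trans h2.le)
  · intro h w' hw'
    rw [← h, ← hw']
    exact pileNorm_evalWord_le w'

/-- With front 0 the letter would have cancelled a syllable, or done nothing, and the length would
not have grown. -/
lemma front_ne_zero_of_geodesic {v : V} {s : stdGens Γ fun _ => N} (hs : IsLetter v s)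
    {x : List (stdGens Γ fun _ => N)} (h : s :: x ∈ geodesicLanguage (stdGens Γ fun _ => N)) :
    front v (pile (evalWord (s :: x))) ≠ 0 := by
  obtain ⟨a, -, ha⟩ := hs.exists_eq_genPow
  intro h0
  have h1 := pileNorm_genPow_mul (evalWord x) v a
  have h2 := pileNorm_evalWord_le x
  rw [geodesic_iff_pileNorm_eq] at h
  rw [evalWord_cons, ha] at h0 h
  rw [front_pile_genPow_mul] at h0
  simp only [h0, ZMod.valMinAbs_zero, Int.natAbs_zero, List.length_cons] at h h1
  lia

/-- The new syllable merges with nothing, and its residue `k ≤ N / 2` has absolute value exactly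
`k`. -/
lemma geodesic_powWord_append {v : V} {k : ℕ} (hk : k ≤ N / 2)
    {x : List (stdGens Γ fun _ => N)} (hx : x ∈ geodesicLanguage (stdGens Γ fun _ => N))
    (h0 : front v (pile (evalWord x)) = 0) :
    powWord Γ (fun _ => N) v k ++ x ∈ geodesicLanguage (stdGens Γ fun _ => N) := by
  rw [geodesic_iff_pileNorm_eq] at hx ⊢
  have h1 := pileNorm_genPow_mul (evalWord x) v (k : ZMod N)
  rw [h0, zero_add, ZMod.valMinAbs_natCast_of_le_half hk, hx] at h1
  rw [evalWord_append, evalWord_powWord, List.length_append, length_powWord]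
  simpa [add_comm] using h1

lemma geodesic_powWord {k : ℕ} (hk : k ≤ N / 2) (v : V) :
    powWord Γ (fun _ => N) v k ∈ geodesicLanguage (stdGens Γ fun _ => N) := by
  simpa using geodesic_powWord_append (v := v) hk nil_mem_geodesicLanguage (front_pile_one v)

lemma geodesic_powWord_append_powWord {k l : ℕ} (hk : k ≤ N / 2) (hl : l ≤ N / 2) {u v : V}
    (huv : Γ.Adj u v) : powWord Γ (fun _ => N) u k ++ powWord Γ (fun _ => N) v l ∈
      geodesicLanguage (stdGens Γ fun _ => N) := by
  refine geodesic_powWord_append hk (geodesic_powWord hl v) ?_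
  rw [evalWord_powWord, ← mul_one (genPow Γ N v _), front_pile_genPow_mul_of_adj _ huv.symm,
    front_pile_one]

/-! ### Continuations of geodesics -/

lemma front_evalWord_cons_eq_zero {v w : V} (hne : v ≠ w) (hvw : ¬ Γ.Adj v w)
    {s : stdGens Γ fun _ => N} (hs : IsLetter w s) {x : List (stdGens Γ fun _ => N)}
    (hx : s :: x ∈ geodesicLanguage (stdGens Γ fun _ => N)) :
    front v (pile (evalWord (s :: x))) = 0 :=
  front_pile_eq_zero (front_ne_zero_of_geodesic hs hx) hne fun h => hvw h.symm

lemma geodesic_powWord_append_cons_iff {v w : V} (hne : v ≠ w) (hvw : ¬ Γ.Adj v w)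
    {s : stdGens Γ fun _ => N} (hs : IsLetter w s) {k : ℕ} (hk : k ≤ N / 2)
    (x : List (stdGens Γ fun _ => N)) :
    powWord Γ (fun _ => N) v k ++ s :: x ∈ geodesicLanguage (stdGens Γ fun _ => N) ↔
      s :: x ∈ geodesicLanguage (stdGens Γ fun _ => N) :=
  ⟨geodesic_of_append_right, fun h =>
    geodesic_powWord_append hk h (front_evalWord_cons_eq_zero hne hvw hs h)⟩

/-- Multiplying by `v ^ l` leaves the front at the neighbour `u` unchanged, so `s` still keeps it
empty. -/
lemma geodesic_powWord_powWord_cons_iff_right {u v w : V} (huv : Γ.Adj u v) (hne : u ≠ w)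
    (huw : ¬ Γ.Adj u w) {s : stdGens Γ fun _ => N} (hs : IsLetter w s) {k l : ℕ}
    (hk : k ≤ N / 2) (x : List (stdGens Γ fun _ => N)) :
    (powWord Γ (fun _ => N) u k ++ powWord Γ (fun _ => N) v l) ++ s :: x ∈
        geodesicLanguage (stdGens Γ fun _ => N) ↔
      powWord Γ (fun _ => N) v l ++ s :: x ∈ geodesicLanguage (stdGens Γ fun _ => N) := by
  rw [List.append_assoc]
  refine ⟨geodesic_of_append_right, fun h => geodesic_powWord_append hk h ?_⟩
  rw [evalWord_append, evalWord_powWord, front_pile_genPow_mul_of_adj _ huv.symm]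
  exact front_evalWord_cons_eq_zero hne huw hs (geodesic_of_append_right h)

/-- Source of the boundary values: least absolute residues modulo `N` never exceed `N / 2`. -/
lemma not_geodesic_powWord (hN : 1 ≤ N) (v : V) : powWord Γ (fun _ => N) v (N / 2 + 1) ∉
    geodesicLanguage (stdGens Γ fun _ => N) := by
  have : NeZero N := ⟨by lia⟩
  rw [geodesic_iff_pileNorm_eq, evalWord_powWord, length_powWord]
  have h1 := pileNorm_genPow_mul (1 : NGP Γ fun _ => N) v ((N / 2 + 1 : ℕ) : ZMod N)
  have h2 := pileNorm_evalWord_le ([] : List (stdGens Γ fun _ => N))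
  have h3 := ZMod.natAbs_valMinAbs_le ((N / 2 + 1 : ℕ) : ZMod N)
  simp only [evalWord_nil, List.length_nil, front_pile_one, mul_one, zero_add, ZMod.valMinAbs_zero,
    Int.natAbs_zero, add_zero] at h1 h2
  lia

end Length

/-! ### The letters are distinct -/

lemma front_genPow (v : V) (a : ZMod N) : front v (pile (genPow Γ N v a)) = a := by
  rw [← mul_one (genPow Γ N v a), front_pile_genPow_mul, front_pile_one, zero_add]

lemma front_genPow_of_ne {u v : V} (h : u ≠ v) (a : ZMod N) :
    front v (pile (genPow Γ N u a)) = 0 := by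
  by_cases ha : a = 0
  · rw [ha, genPow_zero, front_pile_one]
  by_cases huv : Γ.Adj u v
  · rw [← mul_one (genPow Γ N u a), front_pile_genPow_mul_of_adj _ huv, front_pile_one]
  · exact front_pile_eq_zero (by rwa [front_genPow]) h.symm huv

variable (Γ) in
/-- The parametrization of the standard alphabet by vertices and signs. -/
noncomputable def letterEquiv (hN : 3 ≤ N) : V ⊕ V ≃ stdGens Γ (fun _ => N) :=
  Equiv.ofBijective (Sum.elim (letter Γ _) (invLetter Γ N)) <| by
    have h1 : (1 : ZMod N) ≠ 0 := by
      have : Fact (1 < N) := ⟨by lia⟩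
      exact one_ne_zero
    -- This needs `N ≥ 3`: for `N = 2` each generator is its own inverse and gives a single letter.
    have h2 : (1 : ZMod N) ≠ -1 := by
      have : Fact (2 < N) := ⟨by lia⟩
      exact (ZMod.neg_one_ne_one).symm
    have key : ∀ {u v : V} {a b : ZMod N}, b ≠ 0 → genPow Γ N u a = genPow Γ N v b →
        u = v ∧ a = b := by
      intro u v a b hb h
      have hf : front v (pile (genPow Γ N u a)) = b := by rw [h, front_genPow]
      by_cases huv : u = v
      · subst huv
        exact ⟨rfl, by rwa [front_genPow] at hf⟩
      · rw [front_genPow_of_ne huv] at hf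
        exact absurd hf.symm hb
    refine ⟨?_, ?_⟩
    · have hval (x : V ⊕ V) : (Sum.elim (letter Γ _) (invLetter Γ N) x).1 =
          Sum.elim (genPow Γ N · 1) (genPow Γ N · (-1)) x := by
        rcases x with v | v
        · exact (genPow_one Γ N v).symm
        · exact (genPow_neg_one Γ N v).symm
      intro x y h
      have h := congrArg Subtype.val h
      rw [hval, hval] at h
      have h1' : (-1 : ZMod N) ≠ 0 := neg_ne_zero.2 h1
      rcases x with u | u <;> rcases y with v | v
      · rw [(key h1 h).1]
      · exact absurd (key h1' h).2 h2
      · exact absurd (key h1 h).2.symm h2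
      · rw [(key h1' h).1]
    · rintro s
      obtain ⟨v, rfl | rfl⟩ := exists_isLetter s
      · exact ⟨Sum.inl v, rfl⟩
      · exact ⟨Sum.inr v, rfl⟩

/-! ### Inverting a generator -/

section Invert

open scoped Classical in
variable (Γ N) in
/-- The endomorphism that inverts the generator `w` and fixes the others. -/
noncomputable def invert (w : V) : NGP Γ (fun _ => N) →* NGP Γ (fun _ => N) :=
  PresentedGroup.toGroup (f := fun v => if v = w then (gen Γ _ v)⁻¹ else gen Γ _ v) <| by
    rintro r (⟨v, rfl⟩ | ⟨u, v, huv, rfl⟩)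
    · rw [map_pow, FreeGroup.lift_apply_of]
      split_ifs <;> simp [gen_pow_eq_one]
    · simp only [map_mul, map_inv, FreeGroup.lift_apply_of]
      rw [mul_inv_eq_one, mul_inv_eq_iff_eq_mul]
      have h := gen_commute Γ N huv
      split_ifs
      · exact h.inv_inv
      · exact h.inv_left
      · exact h.inv_right
      · exact h

lemma invert_gen_self (w : V) :
    invert Γ N w (gen Γ (fun _ => N) w) = (gen Γ (fun _ => N) w)⁻¹ := by
  rw [invert, gen, PresentedGroup.toGroup.of, if_pos rfl]
  rfl

lemma invert_gen_of_ne {v w : V} (h : v ≠ w) :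
    invert Γ N w (gen Γ (fun _ => N) v) = gen Γ (fun _ => N) v := by
  rw [invert, gen, PresentedGroup.toGroup.of, if_neg h]
  rfl

lemma invert_invert (w : V) (g : NGP Γ (fun _ => N)) : invert Γ N w (invert Γ N w g) = g := by
  have : (invert Γ N w).comp (invert Γ N w) = MonoidHom.id _ := by
    apply PresentedGroup.ext
    intro v
    change invert Γ N w (invert Γ N w (gen Γ _ v)) = gen Γ _ v
    by_cases h : v = w
    · subst h
      rw [invert_gen_self, map_inv, invert_gen_self, inv_inv]
    · rw [invert_gen_of_ne h, invert_gen_of_ne h]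
  exact DFunLike.congr_fun this g

/-- The action of `invert` on the standard alphabet. -/
noncomputable def invertLetter (w : V) (s : stdGens Γ (fun _ => N)) : stdGens Γ (fun _ => N) :=
  ⟨invert Γ N w s, by
    obtain ⟨s, ⟨v, rfl⟩ | ⟨v, rfl⟩⟩ := s <;> by_cases h : v = w
    · subst h
      exact Or.inr ⟨v, (invert_gen_self v).symm⟩
    · exact Or.inl ⟨v, (invert_gen_of_ne h).symm⟩
    · subst h
      exact Or.inl ⟨v, by simp [invert_gen_self]⟩
    · exact Or.inr ⟨v, by simp [invert_gen_of_ne h]⟩⟩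

lemma invertLetter_involutive (w : V) :
    Function.Involutive (invertLetter w : stdGens Γ (fun _ => N) → _) :=
  fun s => Subtype.ext (invert_invert w s.1)

lemma invertLetter_letter_self (w : V) :
    invertLetter w (letter Γ (fun _ => N) w) = invLetter Γ N w :=
  Subtype.ext (invert_gen_self w)

lemma invertLetter_letter_of_ne {v w : V} (h : v ≠ w) :
    invertLetter w (letter Γ (fun _ => N) v) = letter Γ (fun _ => N) v :=
  Subtype.ext (invert_gen_of_ne h)

lemma evalWord_map_invertLetter (w : V) (x : List (stdGens Γ fun _ => N)) :
    evalWord (x.map (invertLetter w)) = invert Γ N w (evalWord x) := by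
  induction x with
  | nil => simp
  | cons s x ih =>
    rw [List.map_cons, evalWord_cons, evalWord_cons, ih, map_mul]
    rfl

lemma geodesic_map_invertLetter_iff (w : V) (x : List (stdGens Γ fun _ => N)) :
    x.map (invertLetter w) ∈ geodesicLanguage (stdGens Γ fun _ => N) ↔
      x ∈ geodesicLanguage (stdGens Γ fun _ => N) := by
  have key : ∀ x : List (stdGens Γ fun _ => N),
      x.map (invertLetter w) ∈ geodesicLanguage (stdGens Γ fun _ => N) →
        x ∈ geodesicLanguage (stdGens Γ fun _ => N) := by
    intro x h x' hx'
    have := h (x'.map (invertLetter w)) (by simp only [evalWord_map_invertLetter, hx'])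
    simpa using this
  refine ⟨key x, fun h => key _ ?_⟩
  rwa [List.map_map, (invertLetter_involutive w).comp_self, List.map_id]

end Invert

end NGP

/-! ### Growth series -/

section Growth

variable {R : Type*} [CommRing R] {α : Type*}

open scoped Classical in
-- Sorts the nonempty words by their first letter.
lemma growthSeries_eq [Fintype α] (l : Language α) : growthSeries R l =
    (if [] ∈ l then 1 else 0) +
      PowerSeries.X * ∑ s : α, growthSeries R (l.leftQuotient [s]) := by
  ext d
  cases d with
  | zero =>
    have : {w : List α | w ∈ l ∧ w.length = 0} = if [] ∈ l then {[]} else ∅ := by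
      ext w
      split_ifs with h
      · simp only [List.length_eq_zero_iff, Set.mem_ofPred_eq, Set.mem_singleton_iff]
        exact ⟨And.right, fun hw => ⟨hw ▸ h, hw⟩⟩
      · simp only [List.length_eq_zero_iff, Set.mem_ofPred_eq, Set.mem_empty_iff_false, iff_false]
        rintro ⟨hw, rfl⟩
        exact h hw
    simp only [growthSeries, PowerSeries.coeff_mk, this, map_add, PowerSeries.coeff_zero_X_mul,
      add_zero]
    split_ifs <;> simp
  | succ d =>
    have h0 : PowerSeries.coeff (d + 1) (if [] ∈ l then (1 : PowerSeries R) else 0) = 0 := by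
      split_ifs <;> simp [PowerSeries.coeff_one]
    rw [map_add, h0, zero_add, PowerSeries.coeff_succ_X_mul, map_sum]
    simp only [growthSeries, PowerSeries.coeff_mk]
    rw [← Nat.cast_sum]
    congr 1
    let e : {w : List α | w ∈ l ∧ w.length = d + 1} ≃
        Σ s : α, {w : List α | w ∈ l.leftQuotient [s] ∧ w.length = d} :=
      { toFun := fun w => match w with
          | ⟨s :: w, h⟩ => ⟨s, w, h.1, Nat.succ_injective h.2⟩
        invFun := fun p => ⟨p.1 :: p.2.1, p.2.2.1, congrArg Nat.succ p.2.2.2⟩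
        left_inv := by
          rintro ⟨_ | ⟨s, w⟩, h⟩
          · exact absurd h.2 (by simp)
          · rfl
        right_inv := fun _ => rfl }
    have hfin (s : α) : Finite {w : List α | w ∈ l.leftQuotient [s] ∧ w.length = d} :=
      (List.finite_length_eq α d).subset fun _ h => h.2
    simp only [← Nat.card_coe_set_eq]
    rw [Nat.card_congr e, Nat.card_sigma]

lemma growthSeries_eq_of_map_mem_iff {f : α → α} (hf : Function.Involutive f) {l l' : Language α}
    (h : ∀ w : List α, w.map f ∈ l' ↔ w ∈ l) : growthSeries R l = growthSeries R l' := by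
  have hmap : Function.Involutive (List.map f) := fun w => by
    rw [List.map_map, hf.comp_self, List.map_id]
  ext d
  simp only [growthSeries, PowerSeries.coeff_mk]
  congr 1
  rw [← Set.ncard_image_of_injective _ hmap.injective, hmap.image_eq_preimage_symm]
  congr 1
  ext w
  simp [← h, -List.map_map, hmap w]

end Growth

namespace NGP

section ContGrowth

variable {R : Type*} [CommRing R] {V : Type*} {Γ : SimpleGraph V} {N : ℕ}

lemma contGrowth_congr {w w' : List (stdGens Γ fun _ => N)}
    (h : ∀ x, w ++ x ∈ geodesicLanguage (stdGens Γ fun _ => N) ↔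
      w' ++ x ∈ geodesicLanguage (stdGens Γ fun _ => N)) :
    contGrowth R Γ (fun _ => N) w = contGrowth R Γ (fun _ => N) w' := by
  rw [contGrowth, contGrowth]
  congr 1
  ext x
  exact h x

/-- Prefixes of geodesics are geodesic. This removes backtracking letters and gives the boundary
values. -/
lemma contGrowth_eq_zero {w : List (stdGens Γ fun _ => N)}
    (h : w ∉ geodesicLanguage (stdGens Γ fun _ => N)) : contGrowth R Γ (fun _ => N) w = 0 := by
  have : (geodesicLanguage (stdGens Γ fun _ => N)).leftQuotient w = 0 := by
    ext x
    exact iff_of_false (fun hx => h (geodesic_of_append_left hx)) (Language.notMem_zero x)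
  rw [contGrowth, this]
  ext d
  simp [growthSeries, Language.notMem_zero]

lemma contGrowth_nil : contGrowth R Γ (fun _ => N) [] = geodesicGrowth R Γ (fun _ => N) := rfl

lemma contGrowth_eq [Fintype V] (hN : 3 ≤ N) {w : List (stdGens Γ fun _ => N)}
    (h : w ∈ geodesicLanguage (stdGens Γ fun _ => N)) : contGrowth R Γ (fun _ => N) w =
      PowerSeries.X * ∑ v, (contGrowth R Γ (fun _ => N) (w ++ [letter Γ _ v]) +
        contGrowth R Γ (fun _ => N) (w ++ [invLetter Γ N v])) + 1 := by
  classical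
  let _ : Fintype (stdGens Γ fun _ => N) := Fintype.ofEquiv _ (letterEquiv Γ hN)
  have h' : [] ∈ (geodesicLanguage (stdGens Γ fun _ => N)).leftQuotient w := by
    simpa [Language.mem_leftQuotient] using h
  rw [contGrowth, growthSeries_eq, if_pos h', ← (letterEquiv Γ hN).sum_comp, Fintype.sum_sum_type,
    ← Finset.sum_add_distrib, add_comm]
  simp only [contGrowth, Language.leftQuotient_append]
  rfl

lemma contGrowth_map_invertLetter (v : V) (w : List (stdGens Γ fun _ => N)) :
    contGrowth R Γ (fun _ => N) (w.map (invertLetter v)) = contGrowth R Γ (fun _ => N) w := by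
  refine (growthSeries_eq_of_map_mem_iff (invertLetter_involutive v) fun x => ?_).symm
  rw [Language.mem_leftQuotient, Language.mem_leftQuotient, ← List.map_append,
    geodesic_map_invertLetter_iff]

lemma map_invertLetter_powWord {v w : V} (h : v ≠ w) (k : ℕ) :
    (powWord Γ (fun _ => N) v k).map (invertLetter w) = powWord Γ (fun _ => N) v k := by
  rw [powWord, List.map_replicate, invertLetter_letter_of_ne h]

/-- The automorphism inverting `v` preserves geodesics and fixes `w`; the factors 2 of the system
come from here. -/
lemma contGrowth_append_invLetter {v : V} {w : List (stdGens Γ fun _ => N)}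
    (h : w.map (invertLetter v) = w) :
    contGrowth R Γ (fun _ => N) (w ++ [invLetter Γ N v]) =
      contGrowth R Γ (fun _ => N) (w ++ [letter Γ _ v]) := by
  rw [← contGrowth_map_invertLetter v (w ++ [letter Γ _ v]), List.map_append, h, List.map_singleton,
    invertLetter_letter_self]

lemma contGrowth_powWord_comm {u v : V} (huv : Γ.Adj u v) (k l : ℕ) :
    contGrowth R Γ (fun _ => N) (powWord Γ _ u k ++ powWord Γ _ v l) =
      contGrowth R Γ (fun _ => N) (powWord Γ _ v l ++ powWord Γ _ u k) :=
  contGrowth_congr fun x => geodesic_powWord_powWord_comm huv k l x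

lemma contGrowth_powWord_powWord_append_letter_comm {u v w : V} (huv : Γ.Adj u v) (k l : ℕ) :
    contGrowth R Γ (fun _ => N) ((powWord Γ _ u k ++ powWord Γ _ v l) ++ [letter Γ _ w]) =
      contGrowth R Γ (fun _ => N) ((powWord Γ _ v l ++ powWord Γ _ u k) ++ [letter Γ _ w]) :=
  contGrowth_congr fun x => by
    rw [List.append_assoc, List.append_assoc (_ ++ _)]
    exact geodesic_powWord_powWord_comm huv k l _

lemma contGrowth_powWord_self {v : V} {k : ℕ} (hk : 1 ≤ k) :
    contGrowth R Γ (fun _ => N) (powWord Γ _ v k ++ [letter Γ _ v]) +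
        contGrowth R Γ (fun _ => N) (powWord Γ _ v k ++ [invLetter Γ N v]) =
      contGrowth R Γ (fun _ => N) (powWord Γ _ v (k + 1)) := by
  rw [contGrowth_eq_zero (not_geodesic_powWord_append_invLetter hk v), add_zero,
    powWord_append_letter]

lemma contGrowth_powWord_powWord_self_right {u v : V} {k l : ℕ} (hl : 1 ≤ l) :
    contGrowth R Γ (fun _ => N) ((powWord Γ _ u k ++ powWord Γ _ v l) ++ [letter Γ _ v]) +
        contGrowth R Γ (fun _ => N) ((powWord Γ _ u k ++ powWord Γ _ v l) ++ [invLetter Γ N v]) =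
      contGrowth R Γ (fun _ => N) (powWord Γ _ u k ++ powWord Γ _ v (l + 1)) := by
  rw [List.append_assoc, List.append_assoc, contGrowth_eq_zero (w := _ ++ (_ ++ [invLetter Γ N v]))
    fun h => not_geodesic_powWord_append_invLetter hl v (geodesic_of_append_right h), add_zero,
    powWord_append_letter]

lemma contGrowth_powWord_powWord_self_left {u v : V} (huv : Γ.Adj u v) {k l : ℕ} (hk : 1 ≤ k) :
    contGrowth R Γ (fun _ => N) ((powWord Γ _ u k ++ powWord Γ _ v l) ++ [letter Γ _ u]) +
        contGrowth R Γ (fun _ => N) ((powWord Γ _ u k ++ powWord Γ _ v l) ++ [invLetter Γ N u]) =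
      contGrowth R Γ (fun _ => N) (powWord Γ _ u (k + 1) ++ powWord Γ _ v l) := by
  rw [contGrowth_powWord_comm huv, ← contGrowth_powWord_powWord_self_right hk]
  congr 1 <;> refine contGrowth_congr fun x => ?_ <;>
    rw [List.append_assoc, List.append_assoc (_ ++ _)] <;>
    exact geodesic_powWord_powWord_comm huv k l _

variable [Fintype V]

lemma contGrowth_powWord_append_letter_of_not_adj {v w : V} (hne : v ≠ w) (hvw : ¬ Γ.Adj v w)
    {k : ℕ} (hk : k ≤ N / 2) :
    contGrowth R Γ (fun _ => N) (powWord Γ _ v k ++ [letter Γ _ w]) =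
      contGrowth R Γ (fun _ => N) (powWord Γ _ w 1) :=
  contGrowth_congr fun x => by
    rw [List.append_assoc]
    exact geodesic_powWord_append_cons_iff hne hvw (isLetter_letter w) hk x

lemma contGrowth_powWord_powWord_append_letter_of_not_adj {u v w : V} (huv : Γ.Adj u v)
    (hne : u ≠ w) (huw : ¬ Γ.Adj u w) {k l : ℕ} (hk : k ≤ N / 2) :
    contGrowth R Γ (fun _ => N) ((powWord Γ _ u k ++ powWord Γ _ v l) ++ [letter Γ _ w]) =
      contGrowth R Γ (fun _ => N) (powWord Γ _ v l ++ [letter Γ _ w]) :=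
  contGrowth_congr fun x => by
    rw [List.append_assoc, List.append_assoc (powWord Γ _ v l)]
    exact geodesic_powWord_powWord_cons_iff_right huv hne huw (isLetter_letter w) hk x

/-- Indicators make the formula uniform in `w`, ready for summation. The last term treats `w = v` as
an ordinary non-neighbour, which the subtraction in the first term corrects. -/
lemma contGrowth_powWord_step [DecidableEq V] [DecidableRel Γ.Adj] {v : V} {k : ℕ} (hk : 1 ≤ k) (hk' : k ≤ N / 2) (w : V) :
    contGrowth R Γ (fun _ => N) (powWord Γ _ v k ++ [letter Γ _ w]) +
        contGrowth R Γ (fun _ => N) (powWord Γ _ v k ++ [invLetter Γ N w]) =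
      (if w = v then contGrowth R Γ (fun _ => N) (powWord Γ _ v (k + 1)) -
        2 * contGrowth R Γ (fun _ => N) (powWord Γ _ v 1) else 0) +
      2 * (if Γ.Adj v w then
        contGrowth R Γ (fun _ => N) (powWord Γ _ v k ++ powWord Γ _ w 1) else 0) +
      2 * (contGrowth R Γ (fun _ => N) (powWord Γ _ w 1) -
        if Γ.Adj v w then contGrowth R Γ (fun _ => N) (powWord Γ _ w 1) else 0) := by
  by_cases hwv : w = v
  · subst hwv
    rw [contGrowth_powWord_self hk]
    simp
  have hvw : v ≠ w := Ne.symm hwv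
  rw [contGrowth_append_invLetter (map_invertLetter_powWord hvw k), if_neg hwv]
  split_ifs with ha
  -- `powWord Γ _ w 1` unfolds to the one-letter word.
  · change _ = 0 + 2 * contGrowth R Γ (fun _ => N) (powWord Γ _ v k ++ [letter Γ _ w]) + _
    ring
  · rw [contGrowth_powWord_append_letter_of_not_adj hvw ha hk']
    ring

/-- The endpoints are neighbours of each other, so the adjacency terms also count `w = u` and `w =
v`; the subtractions in the first two terms undo this, and the last bracket vanishes there. -/
lemma contGrowth_powWord_powWord_step [DecidableEq V] [DecidableRel Γ.Adj] (htri : Γ.CliqueFree 3) {u v : V} (huv : Γ.Adj u v)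
    {k l : ℕ} (hk : 1 ≤ k) (hk' : k ≤ N / 2) (hl : 1 ≤ l) (hl' : l ≤ N / 2) (w : V) :
    contGrowth R Γ (fun _ => N) ((powWord Γ _ u k ++ powWord Γ _ v l) ++ [letter Γ _ w]) +
        contGrowth R Γ (fun _ => N) ((powWord Γ _ u k ++ powWord Γ _ v l) ++ [invLetter Γ N w]) =
      (if w = u then contGrowth R Γ (fun _ => N) (powWord Γ _ u (k + 1) ++ powWord Γ _ v l) -
        2 * contGrowth R Γ (fun _ => N) (powWord Γ _ v l ++ powWord Γ _ u 1) else 0) +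
      (if w = v then contGrowth R Γ (fun _ => N) (powWord Γ _ u k ++ powWord Γ _ v (l + 1)) -
        2 * contGrowth R Γ (fun _ => N) (powWord Γ _ u k ++ powWord Γ _ v 1) else 0) +
      2 * (if Γ.Adj u w then
        contGrowth R Γ (fun _ => N) (powWord Γ _ u k ++ powWord Γ _ w 1) else 0) +
      2 * (if Γ.Adj v w then
        contGrowth R Γ (fun _ => N) (powWord Γ _ v l ++ powWord Γ _ w 1) else 0) +
      2 * (contGrowth R Γ (fun _ => N) (powWord Γ _ w 1) -
        (if Γ.Adj u w then contGrowth R Γ (fun _ => N) (powWord Γ _ w 1) else 0) -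
        if Γ.Adj v w then contGrowth R Γ (fun _ => N) (powWord Γ _ w 1) else 0) := by
  by_cases hwu : w = u
  · subst hwu
    rw [contGrowth_powWord_powWord_self_left huv hk]
    simp [huv.ne, huv.symm]
  by_cases hwv : w = v
  · subst hwv
    rw [contGrowth_powWord_powWord_self_right hl]
    simp [huv.ne', huv]
  have huw : u ≠ w := Ne.symm hwu
  have hvw : v ≠ w := Ne.symm hwv
  rw [contGrowth_append_invLetter (by
    rw [List.map_append, map_invertLetter_powWord huw, map_invertLetter_powWord hvw]),
    if_neg hwu, if_neg hwv]
  by_cases ha : Γ.Adj u w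
  -- Triangle-freeness enters here. The power of `v` can then be moved to the front and dropped.
  · have hb : ¬ Γ.Adj v w := fun hb => by
      classical
      exact htri _ (SimpleGraph.is3Clique_triple_iff.2 ⟨huv, ha, hb⟩)
    rw [contGrowth_powWord_powWord_append_letter_comm huv,
      contGrowth_powWord_powWord_append_letter_of_not_adj huv.symm hvw hb hl']
    simp only [if_pos ha, if_neg hb]
    change _ = 0 + 0 + 2 * contGrowth R Γ (fun _ => N) (powWord Γ _ u k ++ [letter Γ _ w]) + _ + _
    ring
  · rw [contGrowth_powWord_powWord_append_letter_of_not_adj huv huw ha hk']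
    by_cases hb : Γ.Adj v w
    · simp only [if_neg ha, if_pos hb]
      change _ = 0 + 0 + _ + 2 * contGrowth R Γ (fun _ => N) (powWord Γ _ v l ++ [letter Γ _ w]) + _
      ring
    · rw [contGrowth_powWord_append_letter_of_not_adj hvw hb hl']
      simp only [if_neg ha, if_neg hb]
      ring

end ContGrowth

/-! ### Sums over the directed edges of a regular graph -/

section Sums

variable {V M : Type*} [Fintype V] {Γ : SimpleGraph V} [DecidableRel Γ.Adj]

lemma sum_neighborFinset_comm [AddCommMonoid M] (f : V → V → M) :
    ∑ u, ∑ v ∈ Γ.neighborFinset u, f u v = ∑ u, ∑ v ∈ Γ.neighborFinset u, f v u :=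
  Finset.sum_comm' fun u v => by simp [Γ.adj_comm]

lemma sum_ite_adj [AddCommMonoid M] (v : V) (f : V → M) :
    ∑ w, (if Γ.Adj v w then f w else 0) = ∑ w ∈ Γ.neighborFinset v, f w := by
  rw [SimpleGraph.neighborFinset_eq_filter, Finset.sum_filter]

lemma sum_neighborFinset_left [CommRing M] {L : ℕ} (hreg : Γ.IsRegularOfDegree L) (f : V → M) :
    ∑ u, ∑ _v ∈ Γ.neighborFinset u, f u = L * ∑ u, f u := by
  simp [hreg.degree_eq, Finset.mul_sum]

lemma sum_neighborFinset_right [CommRing M] {L : ℕ} (hreg : Γ.IsRegularOfDegree L) (f : V → M) :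
    ∑ u, ∑ v ∈ Γ.neighborFinset u, f v = L * ∑ u, f u := by
  rw [sum_neighborFinset_comm, sum_neighborFinset_left hreg]

end Sums

/-! ### The linear system -/

section System

variable {R : Type*} [CommRing R]

lemma edgeSeries_comm {V : Type*} [Fintype V] (Γ : SimpleGraph V) [DecidableRel Γ.Adj]
    (N k l : ℕ) : edgeSeries R Γ (fun _ => N) k l = edgeSeries R Γ (fun _ => N) l k := by
  rw [edgeSeries, edgeSeries, sum_neighborFinset_comm]
  refine Finset.sum_congr rfl fun u _ => Finset.sum_congr rfl fun v hv => ?_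
  rw [contGrowth_powWord_comm ((SimpleGraph.mem_neighborFinset _ _ _).1 hv).symm]

lemma geodesicGrowth_eq {V : Type*} [Fintype V] (Γ : SimpleGraph V) {N : ℕ} (hN : 3 ≤ N) : geodesicGrowth R Γ (fun _ => N) =
    2 * PowerSeries.X * vertexSeries R Γ (fun _ => N) 1 + 1 := by
  rw [← contGrowth_nil, contGrowth_eq hN nil_mem_geodesicLanguage, vertexSeries]
  have (v : V) : contGrowth R Γ (fun _ => N) ([] ++ [invLetter Γ N v]) =
      contGrowth R Γ (fun _ => N) ([] ++ [letter Γ _ v]) := contGrowth_append_invLetter rfl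
  simp only [this, ← two_mul, ← Finset.mul_sum]
  change PowerSeries.X * (2 * ∑ v, contGrowth R Γ (fun _ => N) (powWord Γ _ v 1)) + 1 = _
  ring

variable {V : Type*} [Fintype V] {Γ : SimpleGraph V} [DecidableRel Γ.Adj] {n L N : ℕ}

/-- In the coefficient `n - L - 1`, `L` accounts for the neighbours and 1 for the correction at `w =
v`. -/
lemma vertexSeries_eq (hn : Fintype.card V = n) (hreg : Γ.IsRegularOfDegree L) (hN : 3 ≤ N)
    {k : ℕ} (hk : 1 ≤ k) (hk' : k ≤ N / 2) : vertexSeries R Γ (fun _ => N) k =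
      PowerSeries.X * (vertexSeries R Γ (fun _ => N) (k + 1) + 2 * edgeSeries R Γ (fun _ => N) 1 k +
        2 * ((n : PowerSeries R) - (L : PowerSeries R) - 1) * vertexSeries R Γ (fun _ => N) 1) +
      (n : PowerSeries R) := by
  classical
  have h (v : V) := contGrowth_eq (R := R) hN (geodesic_powWord (Γ := Γ) hk' v)
  simp only [contGrowth_powWord_step hk hk', Finset.sum_add_distrib, Finset.sum_sub_distrib,
    ← Finset.mul_sum, Finset.sum_ite_eq', Finset.mem_univ, if_true, sum_ite_adj] at h
  rw [edgeSeries_comm, vertexSeries, Finset.sum_congr rfl fun v _ => h v]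
  simp only [Finset.sum_add_distrib, Finset.sum_sub_distrib, ← Finset.mul_sum,
    sum_neighborFinset_right hreg, Finset.sum_const, Finset.card_univ, hn, nsmul_eq_mul]
  simp only [vertexSeries, edgeSeries]
  ring

/-- By regularity each sum over neighbours of one endpoint is repeated `L` times; the endpoint
corrections lower this to `L - 1`. The remaining letters give `2 * (n * L - 2 * L ^ 2)`. -/
lemma edgeSeries_eq (hn : Fintype.card V = n) (hreg : Γ.IsRegularOfDegree L)
    (htri : Γ.CliqueFree 3) (hN : 3 ≤ N) {k l : ℕ} (hk : 1 ≤ k) (hk' : k ≤ N / 2) (hl : 1 ≤ l)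
    (hl' : l ≤ N / 2) : edgeSeries R Γ (fun _ => N) k l =
      PowerSeries.X * (edgeSeries R Γ (fun _ => N) (k + 1) l +
        edgeSeries R Γ (fun _ => N) k (l + 1) +
        2 * ((L : PowerSeries R) - 1) *
          (edgeSeries R Γ (fun _ => N) 1 k + edgeSeries R Γ (fun _ => N) 1 l) +
        2 * (L : PowerSeries R) * ((n : PowerSeries R) - 2 * (L : PowerSeries R)) *
          vertexSeries R Γ (fun _ => N) 1) + (n : PowerSeries R) * (L : PowerSeries R) := by
  classical
  have h (u v : V) (huv : Γ.Adj u v) :=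
    contGrowth_eq (R := R) hN (geodesic_powWord_append_powWord hk' hl' huv)
  have h' (u v : V) (huv : Γ.Adj u v) := (h u v huv).trans <| by
    rw [Finset.sum_congr rfl fun w _ =>
      contGrowth_powWord_powWord_step htri huv hk hk' hl hl' w]
  simp only [Finset.sum_add_distrib, Finset.sum_sub_distrib,
    ← Finset.mul_sum, Finset.sum_ite_eq', Finset.mem_univ, if_true, sum_ite_adj] at h'
  rw [edgeSeries_comm _ _ 1 k, edgeSeries_comm _ _ 1 l, edgeSeries]
  rw [Finset.sum_congr rfl fun u _ => Finset.sum_congr rfl fun v hv =>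
    h' u v ((SimpleGraph.mem_neighborFinset _ _ _).1 hv)]
  -- The correction at `w = u` belongs to the reversed edge.
  have hswap := sum_neighborFinset_comm (Γ := Γ) fun u v =>
    contGrowth R Γ (fun _ => N) (powWord Γ _ u l ++ powWord Γ _ v 1)
  have hleft := sum_neighborFinset_left (M := PowerSeries R) hreg
  have hright := sum_neighborFinset_right (M := PowerSeries R) hreg
  simp only [Finset.sum_add_distrib, Finset.sum_sub_distrib, ← Finset.mul_sum]
  simp only [hleft, hright, ← hswap]
  simp only [vertexSeries, edgeSeries, Finset.sum_const, Finset.card_univ, hn, nsmul_eq_mul]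
  ring

theorem isSolution_series (hn : Fintype.card V = n) (hreg : Γ.IsRegularOfDegree L)
    (htri : Γ.CliqueFree 3) (hN : 3 ≤ N) :
    IsSolution n L (N / 2) (geodesicGrowth R Γ fun _ => N) (vertexSeries R Γ fun _ => N)
      (edgeSeries R Γ fun _ => N) where
  start := geodesicGrowth_eq Γ hN
  vertex _ hk hk' := vertexSeries_eq hn hreg hN hk hk'
  edge _ _ hk hk' hl hl' := edgeSeries_eq hn hreg htri hN hk hk' hl hl'
  vertex_boundary := Finset.sum_eq_zero fun v _ =>
    contGrowth_eq_zero (not_geodesic_powWord (by lia) v)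
  edge_boundary_left _ _ _ := Finset.sum_eq_zero fun u _ => Finset.sum_eq_zero fun _ _ =>
    contGrowth_eq_zero fun h => not_geodesic_powWord (by lia) u (geodesic_of_append_left h)
  edge_boundary_right _ _ _ := Finset.sum_eq_zero fun _ _ => Finset.sum_eq_zero fun v _ =>
    contGrowth_eq_zero fun h => not_geodesic_powWord (by lia) v (geodesic_of_append_right h)

/-! ### Uniqueness of the solution -/

lemma eq_of_forall_X_pow_dvd_sub {f g : PowerSeries R}
    (h : ∀ d : ℕ, PowerSeries.X ^ d ∣ f - g) : f = g := by
  ext d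
  have := PowerSeries.X_pow_dvd_iff.1 (h (d + 1)) d (Nat.lt_succ_self d)
  rwa [map_sub, sub_eq_zero] at this

theorem IsSolution.unique {m : ℕ} (hm : 1 ≤ m) {g g' : PowerSeries R} {a a' : ℕ → PowerSeries R}
    {b b' : ℕ → ℕ → PowerSeries R} (h : IsSolution n L m g a b) (h' : IsSolution n L m g' a' b') :
    g = g' ∧ (∀ k, 1 ≤ k → k ≤ m → a k = a' k) ∧
      ∀ k l, 1 ≤ k → k ≤ m → 1 ≤ l → l ≤ m → b k l = b' k l := by
  -- The constant terms cancel in the differences, and the factor `X` on the right raises the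
  -- divisibility by one; at index `m + 1` both solutions are 0.
  have key (d : ℕ) : (∀ k, 1 ≤ k → k ≤ m → PowerSeries.X ^ d ∣ a k - a' k) ∧
      ∀ k l, 1 ≤ k → k ≤ m → 1 ≤ l → l ≤ m → PowerSeries.X ^ d ∣ b k l - b' k l := by
    induction d with
    | zero => simp
    | succ d ih =>
      obtain ⟨iha, ihb⟩ := ih
      have ha1 := iha 1 le_rfl hm
      refine ⟨fun k hk hk' => ?_, fun k l hk hk' hl hl' => ?_⟩
      · have hs : PowerSeries.X ^ d ∣ a (k + 1) - a' (k + 1) := by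
          rcases hk'.eq_or_lt with rfl | hlt
          · simp [h.vertex_boundary, h'.vertex_boundary]
          · exact iha _ (by lia) hlt
        have hb := ihb 1 k le_rfl hm hk hk'
        rw [h.vertex k hk hk', h'.vertex k hk hk', pow_succ']
        have := mul_dvd_mul_left PowerSeries.X <| dvd_add (dvd_add hs (dvd_mul_of_dvd_right hb 2))
          (dvd_mul_of_dvd_right ha1 (2 * ((n : PowerSeries R) - (L : PowerSeries R) - 1)))
        convert this using 1
        ring
      · have hsk : PowerSeries.X ^ d ∣ b (k + 1) l - b' (k + 1) l := by
          rcases hk'.eq_or_lt with rfl | hlt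
          · simp [h.edge_boundary_left l hl hl', h'.edge_boundary_left l hl hl']
          · exact ihb _ _ (by lia) hlt hl hl'
        have hsl : PowerSeries.X ^ d ∣ b k (l + 1) - b' k (l + 1) := by
          rcases hl'.eq_or_lt with rfl | hlt
          · simp [h.edge_boundary_right k hk hk', h'.edge_boundary_right k hk hk']
          · exact ihb _ _ hk hk' (by lia) hlt
        have hb := dvd_add (ihb 1 k le_rfl hm hk hk') (ihb 1 l le_rfl hm hl hl')
        rw [h.edge k l hk hk' hl hl', h'.edge k l hk hk' hl hl', pow_succ']
        have := mul_dvd_mul_left PowerSeries.X <| dvd_add (dvd_add (dvd_add hsk hsl)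
          (dvd_mul_of_dvd_right hb (2 * ((L : PowerSeries R) - 1))))
          (dvd_mul_of_dvd_right ha1
            (2 * (L : PowerSeries R) * ((n : PowerSeries R) - 2 * (L : PowerSeries R))))
        convert this using 1
        ring
  have ha (k : ℕ) (hk : 1 ≤ k) (hk' : k ≤ m) : a k = a' k :=
    eq_of_forall_X_pow_dvd_sub fun d => (key d).1 k hk hk'
  refine ⟨?_, ha, fun k l hk hk' hl hl' =>
    eq_of_forall_X_pow_dvd_sub fun d => (key d).2 k l hk hk' hl hl'⟩
  rw [h.start, h'.start, ha 1 le_rfl hm]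

end System

end NGP

theorem theorem7p1 {V : Type*} [Fintype V] (Γ : SimpleGraph V) [DecidableRel Γ.Adj]
    (n L N : ℕ) (hn : Fintype.card V = n) (hreg : Γ.IsRegularOfDegree L) (htri : Γ.CliqueFree 3)
    (hN : 3 ≤ N) (R : Type*) [CommRing R] :
    -- the geodesic growth series and the auxiliary series solve the system
    NGP.IsSolution n L (N / 2)
      (NGP.geodesicGrowth R Γ fun _ => N)
      (NGP.vertexSeries R Γ fun _ => N)
      (NGP.edgeSeries R Γ fun _ => N) ∧
    -- the auxiliary series of edges depend only on the unordered pair of indices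
    (∀ k l : ℕ, NGP.edgeSeries R Γ (fun _ => N) k l = NGP.edgeSeries R Γ (fun _ => N) l k) ∧
    -- the system determines them
    ∀ (g : PowerSeries R) (a : ℕ → PowerSeries R) (b : ℕ → ℕ → PowerSeries R),
      NGP.IsSolution n L (N / 2) g a b →
        g = NGP.geodesicGrowth R Γ (fun _ => N) ∧
        (∀ k, 1 ≤ k → k ≤ N / 2 → a k = NGP.vertexSeries R Γ (fun _ => N) k) ∧
        (∀ k l, 1 ≤ k → k ≤ N / 2 → 1 ≤ l → l ≤ N / 2 →
          b k l = NGP.edgeSeries R Γ (fun _ => N) k l) := by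
  have hsol := NGP.isSolution_series (R := R) hn hreg htri hN
  exact ⟨hsol, NGP.edgeSeries_comm Γ N, fun g a b h => h.unique (by lia) hsol⟩
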